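/- **Conventions.** Strict tensor categories are small; $\mathbf{Str.T}$ is the category of small strict tensor categories and strict tensor functors. A *tensor scheme* $\mathcal D$ consists of a set $Ob(\mathcal D)$, a set $Mor(\mathcal D)$ and two maps $s,t$ assigning to each $f\in Mor(\mathcal D)$ a source word $s(f)=x_1\cdots x_m$ and a target word $t(f)=y_1\cdots y_n$ in $Ob(\mathcal D)$ (written $f:x_1\cdots x_m\to y_1\cdots y_n$); a morphism of tensor schemes is a pair of maps on objects and on morphisms compatible with $s$ and $t$. This gives the category $\mathbf{T.Sch}$. The statement below is asserted for each of the two conventions: (a) $m,n\ge 0$ are arbitrary, here and in the prime diagrams below; (b) $m,n\ge 1$ is required, here and in the prime diagrams below. The *free functor* $F:\mathbf{T.Sch}\to\mathbf{Str.T}$ sends $\mathcal D$ to the free strict tensor category on $\mathcal D$: its objects are the words (the null word $\varnothing$ included) in $Ob(\mathcal D)$, its morphisms are the isomorphism classes of planar diagrams in $\mathcal D$, i.e. composites of levels $\mathrm{id}_u\otimes f\otimes \mathrm{id}_v$ with $u,v$ words and $f\in Mor(\mathcal D)$, modulo interchange of adjacent independent levels; the tensor product is juxtaposition and the composition is stacking.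 For $f\in Mor(\mathcal D)$ let $[f]\in F(\mathcal D)$ be the diagram with a single vertex, decorated by $f$, and no other strands. The functor $U:\mathbf{Str.T}\to\mathbf{T.Sch}$ sends $\mathcal V$ to the tensor scheme with objects $Ob(\mathcal V)$ whose morphisms $x_1\cdots x_m\to y_1\cdots y_n$ are the *prime diagrams* in $\mathcal V$: one vertex with input strands $x_1,\dots,x_m$ and output strands $y_1,\dots,y_n$, decorated by a morphism $x_1\otimes\cdots\otimes x_m\to y_1\otimes\cdots\otimes y_n$ of $\mathcal V$. One has $F\dashv U$; the counit $\varepsilon_{\mathcal V}:FU(\mathcal V)\to\mathcal V$ is the evaluation of diagrams, and the unit sends $f:x_1\cdots x_m\to y_1\cdots y_n$ to the prime diagram in $F(\mathcal D)$ with strands the one-letter words $x_1,\dots,x_m$ and $y_1,\dots,y_n$, decorated by $[f]$. A *tensor manifold* $(\mathcal D,\varepsilon)$ is an algebra over the resulting monad $T=UF$ on $\mathbf{T.Sch}$; tensor manifolds and algebra morphisms form the category $\mathbf{T.Sch}^T$. The *comparison functor* $\Phi:\mathbf{Str.T}\to\mathbf{T.Sch}^T$ sends $\mathcal V$ to $(U\mathcal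 V,U\varepsilon_{\mathcal V})$ and a strict tensor functor $K$ to $U(K)$. Let $(\mathcal D,\varepsilon)$ be a tensor manifold. For a diagram $\gamma:u\to v$ in $F(\mathcal D)$ let $\langle\gamma\rangle$ be the value of $\varepsilon$ on the prime diagram in $F(\mathcal D)$ with the single input strand $u$ and the single output strand $v$ ($u$ and $v$ regarded as objects of $F(\mathcal D)$), decorated by $\gamma$; it is a morphism $\varepsilon(u)\to\varepsilon(v)$ of $\mathcal D$ with one-letter source and target. The functor $\Psi:\mathbf{T.Sch}^T\to\mathbf{Str.T}$ is defined as follows. The objects of $\Psi(\mathcal D,\varepsilon)$ are those of $\mathcal D$; its morphisms $x\to y$ are the morphisms of $\mathcal D$ with source the one-letter word $x$ and target the one-letter word $y$; $x\otimes y=\varepsilon(xy)$, the unit object is $\varepsilon(\varnothing)$, $f\otimes g=\langle [f]\otimes[g]\rangle$, $g\circ f=\langle [g]\circ[f]\rangle$, and $\mathrm{Id}_x=\langle \mathrm{id}_x\rangle$. A morphism $\varphi$ of tensor manifolds induces $\Psi(\varphi)$ by restriction. The morphism of tensor schemes $\varepsilon_*:\mathcal D\to U\Psi(\mathcal D,\varepsilon)$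 is the identity on objects and sends $f:x_1\cdots x_m\to y_1\cdots y_n$ to the prime diagram $x_1\cdots x_m\to y_1\cdots y_n$ in $\Psi(\mathcal D,\varepsilon)$ decorated by $\langle[f]\rangle$. **Theorem.** $\varepsilon_*$ is a morphism of tensor manifolds $(\mathcal D,\varepsilon)\to\Phi\Psi(\mathcal D,\varepsilon)$, and $\Psi$ is left adjoint to $\Phi$ with unit $\varepsilon_*$. That is, for every tensor manifold $(\mathcal D,\varepsilon)$ and every strict tensor category $\mathcal V$, the map $K\mapsto \Phi(K)\circ\varepsilon_*$ is a bijection $$\mathrm{Hom}_{\mathbf{Str.T}}(\Psi(\mathcal D,\varepsilon),\mathcal V)\;\cong\;\mathrm{Hom}_{\mathbf{T.Sch}^T}((\mathcal D,\varepsilon),\Phi(\mathcal V)),$$ natural in $(\mathcal D,\varepsilon)$ and in $\mathcal V$. -/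

import Mathlib

open CategoryTheory

universe u

namespace TensorManifolds

/-! ## Strict tensor categories -/

/-- A (small) strict tensor category, given by its set of objects and its set of morphisms.
The tensor product of objects and of morphisms is written multiplicatively; `1 : Ob` is the unit
object.  `comp g f h` is the composite "`g` after `f`". -/
structure StrictTensorCat : Type (u + 1) where
  Ob : Type u
  Mor : Type u
  [monoidOb : Monoid Ob]
  [monoidMor : Monoid Mor]
  dom : Mor →* Ob
  cod : Mor →* Ob
  id : Ob →* Mor
  comp : ∀ g f : Mor, cod f = dom g → Mor
  dom_id : ∀ x, dom (id x) = x
  cod_id : ∀ x, cod (id x) = x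
  dom_comp : ∀ g f h, dom (comp g f h) = dom f
  cod_comp : ∀ g f h, cod (comp g f h) = cod g
  comp_id : ∀ f, comp f (id (dom f)) (cod_id _) = f
  id_comp : ∀ f, comp (id (cod f)) f (dom_id _).symm = f
  assoc : ∀ (k g f : Mor) (h₁ : cod f = dom g) (h₂ : cod g = dom k),
    comp k (comp g f h₁) ((cod_comp g f h₁).trans h₂) =
      comp (comp k g h₂) f (h₁.trans (dom_comp k g h₂).symm)
  interchange : ∀ (g g' f f' : Mor) (h : cod f = dom g) (h' : cod f' = dom g'),
    comp (g * g') (f * f') (by rw [map_mul, map_mul, h, h']) = comp g f h * comp g' f' h'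

attribute [instance] StrictTensorCat.monoidOb StrictTensorCat.monoidMor

namespace StrictTensorCat

/-- Strict tensor functors. -/
structure Hom (V W : StrictTensorCat.{u}) : Type u where
  ob : V.Ob →* W.Ob
  mor : V.Mor →* W.Mor
  dom_mor : ∀ f, W.dom (mor f) = ob (V.dom f)
  cod_mor : ∀ f, W.cod (mor f) = ob (V.cod f)
  mor_id : ∀ x, mor (V.id x) = W.id (ob x)
  mor_comp : ∀ g f h, mor (V.comp g f h) =
    W.comp (mor g) (mor f) (by rw [cod_mor, dom_mor, h])

theorem Hom.ext' {V W : StrictTensorCat.{u}} {K L : Hom V W} (h₁ : ∀ x, K.ob x = L.ob x)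
    (h₂ : ∀ f, K.mor f = L.mor f) : K = L := by
  obtain ⟨a, b, _, _, _, _⟩ := K
  obtain ⟨a', b', _, _, _, _⟩ := L
  obtain rfl : a = a' := MonoidHom.ext h₁
  obtain rfl : b = b' := MonoidHom.ext h₂
  rfl

/-- The category of small strict tensor categories and strict tensor functors. -/
instance : Category StrictTensorCat.{u} where
  Hom := Hom
  id V :=
    { ob := MonoidHom.id _
      mor := MonoidHom.id _
      dom_mor := fun _ => rfl
      cod_mor := fun _ => rfl
      mor_id := fun _ => rfl
      mor_comp := fun _ _ _ => rfl }
  comp K L :=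
    { ob := L.ob.comp K.ob
      mor := L.mor.comp K.mor
      dom_mor := fun f => by simp [L.dom_mor, K.dom_mor]
      cod_mor := fun f => by simp [L.cod_mor, K.cod_mor]
      mor_id := fun x => by simp [L.mor_id, K.mor_id]
      mor_comp := fun g f h => by simp [L.mor_comp, K.mor_comp] }
  id_comp _ := rfl
  comp_id _ := rfl
  assoc _ _ _ := rfl

theorem comp_congr (V : StrictTensorCat.{u}) {g g' f f' : V.Mor} (hg : g = g') (hf : f = f')
    (h : V.cod f = V.dom g) (h' : V.cod f' = V.dom g') : V.comp g f h = V.comp g' f' h' := by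
  subst hg; subst hf; rfl

theorem id_comp' (V : StrictTensorCat.{u}) {f : V.Mor} {x : V.Ob} (h : V.cod f = V.dom (V.id x)) :
    V.comp (V.id x) f h = f := by
  obtain rfl : V.cod f = x := h.trans (V.dom_id x)
  exact V.id_comp f

theorem comp_id' (V : StrictTensorCat.{u}) {f : V.Mor} {x : V.Ob} (h : V.cod (V.id x) = V.dom f) :
    V.comp f (V.id x) h = f := by
  obtain rfl : x = V.dom f := (V.cod_id x).symm.trans h
  exact V.comp_id f

end StrictTensorCat

/-! ## Tensor schemes -/

/-- A tensor scheme: a set of objects and a set of morphisms, each with a source and a target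
which are words in the objects.  If `p = true`, only morphisms with non-empty source and
non-empty target are allowed (every vertex of a diagram has inputs and outputs); if `p = false`,
there is no restriction. -/
structure TensorScheme (p : Bool) : Type (u + 1) where
  Ob : Type u
  Mor : Type u
  src : Mor → List Ob
  tgt : Mor → List Ob
  src_ne : p = true → ∀ f, src f ≠ []
  tgt_ne : p = true → ∀ f, tgt f ≠ []

namespace TensorScheme

variable {p : Bool}

/-- Morphisms of tensor schemes. -/
structure Hom (D E : TensorScheme.{u} p) : Type u where
  ob : D.Ob → E.Ob
  mor : D.Mor → E.Mor
  src_mor : ∀ f, E.src (mor f) = (D.src f).map ob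
  tgt_mor : ∀ f, E.tgt (mor f) = (D.tgt f).map ob

theorem Hom.ext' {D E : TensorScheme.{u} p} {K L : Hom D E} (h₁ : ∀ x, K.ob x = L.ob x)
    (h₂ : ∀ f, K.mor f = L.mor f) : K = L := by
  obtain ⟨a, b, _, _⟩ := K
  obtain ⟨a', b', _, _⟩ := L
  obtain rfl : a = a' := funext h₁
  obtain rfl : b = b' := funext h₂
  rfl

/-- The category of tensor schemes. -/
instance : Category (TensorScheme.{u} p) where
  Hom := Hom
  id D := ⟨fun x => x, fun f => f, fun _ => by simp, fun _ => by simp⟩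
  comp K L := ⟨fun x => L.ob (K.ob x), fun f => L.mor (K.mor f),
    fun f => by simp [L.src_mor, K.src_mor, Function.comp_def],
    fun f => by simp [L.tgt_mor, K.tgt_mor, Function.comp_def]⟩
  id_comp _ := rfl
  comp_id _ := rfl
  assoc _ _ _ := rfl

end TensorScheme

/-! ## Planar diagrams and the free strict tensor category on a tensor scheme

A planar diagram is written level by level, from top to bottom; a level is an essential prime
diagram, that is, one vertex with some parallel strands to its left and to its right.  Two such
composites represent isomorphic planar diagrams iff they differ by interchanges of adjacent
independent levels. -/

variable {p : Bool}

/-- A level: the vertex `gen` with strands `left` and `right` at its sides. -/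
structure Layer (D : TensorScheme.{u} p) : Type u where
  left : List D.Ob
  gen : D.Mor
  right : List D.Ob

namespace Layer

variable {D E : TensorScheme.{u} p}

/-- The input word of a level. -/
def dom (l : Layer D) : List D.Ob := l.left ++ D.src l.gen ++ l.right

/-- The output word of a level. -/
def cod (l : Layer D) : List D.Ob := l.left ++ D.tgt l.gen ++ l.right

/-- Add strands at both sides of a level. -/
def whisker (u v : List D.Ob) (l : Layer D) : Layer D := ⟨u ++ l.left, l.gen, l.right ++ v⟩

/-- Relabel a level along a morphism of tensor schemes. -/
def map (φ : D ⟶ E) (l : Layer D) : Layer E := ⟨l.left.map φ.ob, φ.mor l.gen, l.right.map φ.ob⟩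

end Layer

/-- Interchange of two adjacent independent levels. -/
inductive Interchange (D : TensorScheme.{u} p) : FreeMonoid (Layer D) → FreeMonoid (Layer D) → Prop
  | swap (u v w : List D.Ob) (f g : D.Mor) : Interchange D
      (FreeMonoid.of ⟨u, f, v ++ D.src g ++ w⟩ * FreeMonoid.of ⟨u ++ D.tgt f ++ v, g, w⟩)
      (FreeMonoid.of ⟨u ++ D.src f ++ v, g, w⟩ * FreeMonoid.of ⟨u, f, v ++ D.tgt g ++ w⟩)

/-- Sequences of levels modulo interchange. -/
abbrev Levels (D : TensorScheme.{u} p) : Type u := PresentedMonoid (Interchange D)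

/-- The sequence of levels `ls` leads from the word `x` to the word `y`. -/
def Composable {D : TensorScheme.{u} p} : List D.Ob → List (Layer D) → List D.Ob → Prop
  | x, [], y => x = y
  | x, l :: ls, y => x = l.dom ∧ Composable l.cod ls y

/-- The class of a sequence of levels. -/
def Levels.mk {D : TensorScheme.{u} p} (ls : List (Layer D)) : Levels D :=
  PresentedMonoid.mk (Interchange D) (FreeMonoid.ofList ls)

/-- Isomorphism classes of planar diagrams in `D`. -/
structure Diag (D : TensorScheme.{u} p) : Type u where
  src : List D.Ob
  tgt : List D.Ob
  cls : Levels D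
  valid : ∃ ls, Levels.mk ls = cls ∧ Composable src ls tgt

section Levels

variable {D E : TensorScheme.{u} p}

theorem Levels.mk_nil : (Levels.mk [] : Levels D) = 1 := rfl

theorem Levels.mk_append (l l' : List (Layer D)) :
    Levels.mk (l ++ l') = Levels.mk l * Levels.mk l' := rfl

theorem Levels.mk_cons (a : Layer D) (l : List (Layer D)) :
    Levels.mk (a :: l) = Levels.mk [a] * Levels.mk l := rfl

theorem Composable.append : ∀ {x y z : List D.Ob} {l l' : List (Layer D)},
    Composable x l y → Composable y l' z → Composable x (l ++ l') z
  | _, _, _, [], _, h, h' => by cases h; exact h'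
  | _, _, _, _ :: _, _, h, h' => ⟨h.1, h.2.append h'⟩

theorem Layer.dom_whisker (u v : List D.Ob) (l : Layer D) :
    (l.whisker u v).dom = u ++ l.dom ++ v := by
  simp [Layer.dom, Layer.whisker]

theorem Layer.cod_whisker (u v : List D.Ob) (l : Layer D) :
    (l.whisker u v).cod = u ++ l.cod ++ v := by
  simp [Layer.cod, Layer.whisker]

theorem Layer.dom_map (φ : D ⟶ E) (l : Layer D) : (l.map φ).dom = l.dom.map φ.ob := by
  simp [Layer.dom, Layer.map, φ.src_mor]

theorem Layer.cod_map (φ : D ⟶ E) (l : Layer D) : (l.map φ).cod = l.cod.map φ.ob := by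
  simp [Layer.cod, Layer.map, φ.tgt_mor]

theorem Composable.whisker (u v : List D.Ob) : ∀ {x y : List D.Ob} {l : List (Layer D)},
    Composable x l y → Composable (u ++ x ++ v) (l.map (Layer.whisker u v)) (u ++ y ++ v)
  | _, _, [], h => by cases h; exact rfl
  | _, _, a :: _, h => by
    refine ⟨by rw [Layer.dom_whisker, h.1], ?_⟩
    rw [Layer.cod_whisker]
    exact h.2.whisker u v

theorem Composable.map (φ : D ⟶ E) : ∀ {x y : List D.Ob} {l : List (Layer D)},
    Composable x l y → Composable (x.map φ.ob) (l.map (Layer.map φ)) (y.map φ.ob)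
  | _, _, [], h => by cases h; exact rfl
  | _, _, a :: _, h => by
    refine ⟨by rw [Layer.dom_map, h.1], ?_⟩
    rw [Layer.cod_map]
    exact h.2.map φ

/-- Two independent levels can be interchanged. -/
theorem Levels.swap (u v w : List D.Ob) (f g : D.Mor) :
    Levels.mk [⟨u, f, v ++ D.src g ++ w⟩, ⟨u ++ D.tgt f ++ v, g, w⟩] =
      Levels.mk [⟨u ++ D.src f ++ v, g, w⟩, ⟨u, f, v ++ D.tgt g ++ w⟩] :=
  PresentedMonoid.mk_eq_mk_of_rel (.swap u v w f g)

/-- Add strands at both sides of a sequence of levels. -/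
def Levels.whisker (u v : List D.Ob) : Levels D →* Levels D :=
  PresentedMonoid.lift (fun l => Levels.mk [l.whisker u v]) (by
    rintro _ _ ⟨a, b, c, f, g⟩
    simp only [map_mul, FreeMonoid.lift_eval_of, ← Levels.mk_append]
    have := Levels.swap (u ++ a) b (c ++ v) f g
    simpa [Layer.whisker] using this)

/-- Relabel a sequence of levels along a morphism of tensor schemes. -/
def Levels.map (φ : D ⟶ E) : Levels D →* Levels E :=
  PresentedMonoid.lift (fun l => Levels.mk [l.map φ]) (by
    rintro _ _ ⟨a, b, c, f, g⟩
    simp only [map_mul, FreeMonoid.lift_eval_of, ← Levels.mk_append]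
    have := Levels.swap (a.map φ.ob) (b.map φ.ob) (c.map φ.ob) (φ.mor f) (φ.mor g)
    simpa [Layer.map, φ.src_mor, φ.tgt_mor] using this)

theorem Levels.whisker_mk (u v : List D.Ob) : ∀ l : List (Layer D),
    Levels.whisker u v (Levels.mk l) = Levels.mk (l.map (Layer.whisker u v))
  | [] => map_one _
  | a :: l => by
    rw [Levels.mk_cons, map_mul, Levels.whisker_mk u v l, List.map_cons,
      Levels.mk_cons (Layer.whisker u v a)]
    rfl

theorem Levels.map_mk (φ : D ⟶ E) : ∀ l : List (Layer D),
    Levels.map φ (Levels.mk l) = Levels.mk (l.map (Layer.map φ))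
  | [] => map_one _
  | a :: l => by
    rw [Levels.mk_cons, map_mul, Levels.map_mk φ l, List.map_cons,
      Levels.mk_cons (Layer.map φ a)]
    rfl

theorem Levels.exists_mk (c : Levels D) : ∃ l, Levels.mk l = c :=
  PresentedMonoid.inductionOn c fun a => ⟨FreeMonoid.toList a, rfl⟩

theorem Levels.whisker_nil (c : Levels D) : Levels.whisker [] [] c = c := by
  obtain ⟨l, rfl⟩ := c.exists_mk
  have h : l.map (Layer.whisker [] []) = l := by
    conv_rhs => rw [← List.map_id l]
    refine List.map_congr_left fun a _ => ?_
    simp [Layer.whisker]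
  rw [Levels.whisker_mk, h]

theorem Levels.whisker_whisker (u v u' v' : List D.Ob) (c : Levels D) :
    Levels.whisker u v (Levels.whisker u' v' c) = Levels.whisker (u ++ u') (v' ++ v) c := by
  obtain ⟨l, rfl⟩ := c.exists_mk
  simp only [Levels.whisker_mk, List.map_map]
  congr 2
  funext a
  simp [Layer.whisker]

theorem Levels.map_whisker (φ : D ⟶ E) (u v : List D.Ob) (c : Levels D) :
    Levels.map φ (Levels.whisker u v c) =
      Levels.whisker (u.map φ.ob) (v.map φ.ob) (Levels.map φ c) := by
  obtain ⟨l, rfl⟩ := c.exists_mk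
  simp only [Levels.whisker_mk, Levels.map_mk, List.map_map]
  congr 2
  funext a
  simp [Layer.whisker, Layer.map]

/-- Interchange for one level and a sequence of levels. -/
theorem Levels.exchange_one (a : Layer D) : ∀ {x' y' : List D.Ob} {l' : List (Layer D)},
    Composable x' l' y' →
    Levels.whisker a.dom [] (Levels.mk l') * Levels.whisker [] y' (Levels.mk [a]) =
      Levels.whisker [] x' (Levels.mk [a]) * Levels.whisker a.cod [] (Levels.mk l')
  | _, _, [], h => by cases h; simp [Levels.mk_nil]
  | _, y', b :: l', h => by
    obtain ⟨rfl, h⟩ := h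
    have ih := Levels.exchange_one a h
    have hs : Levels.whisker a.dom [] (Levels.mk [b]) * Levels.whisker [] b.cod (Levels.mk [a]) =
        Levels.whisker [] b.dom (Levels.mk [a]) * Levels.whisker a.cod [] (Levels.mk [b]) := by
      have := Levels.swap a.left (a.right ++ b.left) b.right a.gen b.gen
      simp only [Levels.whisker_mk, ← Levels.mk_append]
      simpa [Layer.whisker, Layer.dom, Layer.cod] using this.symm
    rw [Levels.mk_cons, map_mul, map_mul, mul_assoc, ih, ← mul_assoc, hs, mul_assoc]

/-- Interchange for two sequences of levels. -/
theorem Levels.exchange {x' y' : List D.Ob} {l' : List (Layer D)} (h' : Composable x' l' y') :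
    ∀ {x y : List D.Ob} {l : List (Layer D)}, Composable x l y →
    Levels.whisker x [] (Levels.mk l') * Levels.whisker [] y' (Levels.mk l) =
      Levels.whisker [] x' (Levels.mk l) * Levels.whisker y [] (Levels.mk l')
  | _, _, [], h => by cases h; simp [Levels.mk_nil]
  | _, _, a :: l, h => by
    obtain ⟨rfl, h⟩ := h
    have ih := Levels.exchange h' h
    rw [Levels.mk_cons, map_mul, map_mul, ← mul_assoc, Levels.exchange_one a h', mul_assoc, ih,
      mul_assoc]

end Levels

namespace Diag

variable {D E : TensorScheme.{u} p}

theorem ext' {f g : Diag D} (h₁ : f.src = g.src) (h₂ : f.tgt = g.tgt) (h₃ : f.cls = g.cls) :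
    f = g := by
  cases f; cases g; cases h₁; cases h₂; cases h₃; rfl

/-- The identity diagram (only strands) on a word. -/
def id (x : List D.Ob) : Diag D := ⟨x, x, 1, [], rfl, rfl⟩

/-- Vertical composition: `g` below `f`. -/
def comp (g f : Diag D) (h : f.tgt = g.src) : Diag D where
  src := f.src
  tgt := g.tgt
  cls := f.cls * g.cls
  valid := by
    obtain ⟨l, hl, h₁⟩ := f.valid
    obtain ⟨l', hl', h₂⟩ := g.valid
    exact ⟨l ++ l', by rw [Levels.mk_append, hl, hl'], h₁.append (h ▸ h₂)⟩

/-- Horizontal composition: `f` to the left of `g`. -/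
def tensor (f g : Diag D) : Diag D where
  src := f.src ++ g.src
  tgt := f.tgt ++ g.tgt
  cls := f.cls.whisker [] g.src * g.cls.whisker f.tgt []
  valid := by
    obtain ⟨l, hl, h₁⟩ := f.valid
    obtain ⟨l', hl', h₂⟩ := g.valid
    refine ⟨l.map (Layer.whisker [] g.src) ++ l'.map (Layer.whisker f.tgt []), ?_, ?_⟩
    · rw [Levels.mk_append, ← Levels.whisker_mk, ← Levels.whisker_mk, hl, hl']
    · have a₁ := h₁.whisker [] g.src
      have a₂ := h₂.whisker f.tgt []
      simp only [List.nil_append, List.append_nil] at a₁ a₂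
      exact a₁.append a₂

/-- The diagram with exactly one vertex, decorated by `f`, and no further strands. -/
def gen (f : D.Mor) : Diag D :=
  ⟨D.src f, D.tgt f, Levels.mk [⟨[], f, []⟩], [⟨[], f, []⟩], rfl,
    by simp [Composable, Layer.dom, Layer.cod]⟩

/-- Relabel a diagram along a morphism of tensor schemes. -/
def map (φ : D ⟶ E) (f : Diag D) : Diag E where
  src := f.src.map φ.ob
  tgt := f.tgt.map φ.ob
  cls := f.cls.map φ
  valid := by
    obtain ⟨l, hl, h⟩ := f.valid
    exact ⟨l.map (Layer.map φ), by rw [← Levels.map_mk, hl], h.map φ⟩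

instance : Monoid (Diag D) where
  mul := tensor
  one := id []
  one_mul f := ext' rfl rfl (by
    change Levels.whisker [] f.src 1 * f.cls.whisker [] [] = f.cls
    rw [map_one, one_mul, Levels.whisker_nil])
  mul_one f := ext' (List.append_nil _) (List.append_nil _) (by
    change f.cls.whisker [] [] * Levels.whisker f.tgt [] 1 = f.cls
    rw [map_one, mul_one, Levels.whisker_nil])
  mul_assoc f g h := ext' (List.append_assoc _ _ _) (List.append_assoc _ _ _) (by
    change (f.cls.whisker [] g.src * g.cls.whisker f.tgt []).whisker [] h.src *
        h.cls.whisker (f.tgt ++ g.tgt) [] =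
      f.cls.whisker [] (g.src ++ h.src) *
        (g.cls.whisker [] h.src * h.cls.whisker g.tgt []).whisker f.tgt []
    simp [map_mul, Levels.whisker_whisker, mul_assoc])

theorem mul_def (f g : Diag D) : f * g = tensor f g := rfl

theorem one_def : (1 : Diag D) = id [] := rfl

end Diag

/-- Words, with concatenation as product and the null word as unit. -/
instance wordMonoid (α : Type u) : Monoid (List α) where
  mul x y := x ++ y
  one := []
  one_mul _ := rfl
  mul_one := List.append_nil
  mul_assoc := List.append_assoc

theorem word_mul {α : Type u} (x y : List α) : x * y = x ++ y := rfl

theorem word_one {α : Type u} : (1 : List α) = [] := rfl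

/-- The free strict tensor category on a tensor scheme: objects are words, morphisms are
isomorphism classes of planar diagrams. -/
abbrev freeObj (D : TensorScheme.{u} p) : StrictTensorCat.{u} where
  Ob := List D.Ob
  Mor := Diag D
  dom := ⟨⟨Diag.src, rfl⟩, fun _ _ => rfl⟩
  cod := ⟨⟨Diag.tgt, rfl⟩, fun _ _ => rfl⟩
  id := ⟨⟨Diag.id, rfl⟩, fun x y => Diag.ext' rfl rfl (by
    change (1 : Levels D) = Levels.whisker [] y 1 * Levels.whisker x [] 1
    simp)⟩
  comp g f h := Diag.comp g f h
  dom_id _ := rfl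
  cod_id _ := rfl
  dom_comp _ _ _ := rfl
  cod_comp _ _ _ := rfl
  comp_id f := Diag.ext' rfl rfl (one_mul _)
  id_comp f := Diag.ext' rfl rfl (mul_one _)
  assoc k g f h₁ h₂ := Diag.ext' rfl rfl (mul_assoc _ _ _)
  interchange g g' f f' h h' := Diag.ext' rfl rfl (by
    obtain ⟨gs, gt, gc, l, rfl, hl⟩ := g
    obtain ⟨fs', ft', fc', l', rfl, hl'⟩ := f'
    obtain ⟨fs, ft, fc, hf⟩ := f
    obtain ⟨gs', gt', gc', hg⟩ := g'
    obtain rfl : ft = gs := h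
    obtain rfl : ft' = gs' := h'
    change (fc.whisker [] fs' * (Levels.mk l').whisker ft []) *
        ((Levels.mk l).whisker [] ft' * gc'.whisker gt []) =
      (fc * Levels.mk l).whisker [] fs' * (Levels.mk l' * gc').whisker gt []
    rw [map_mul, map_mul, mul_assoc, ← mul_assoc (Levels.whisker ft [] _),
      Levels.exchange hl' hl]
    simp only [mul_assoc])

/-- Relabelling of diagrams is a strict tensor functor. -/
def freeMap {D E : TensorScheme.{u} p} (φ : D ⟶ E) : freeObj D ⟶ freeObj E where
  ob := ⟨⟨List.map φ.ob, rfl⟩, fun _ _ => List.map_append⟩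
  mor := ⟨⟨Diag.map φ, Diag.ext' rfl rfl (map_one (Levels.map φ))⟩, fun f g =>
    Diag.ext' List.map_append List.map_append (by
      change Levels.map φ (f.cls.whisker [] g.src * g.cls.whisker f.tgt []) =
        (f.cls.map φ).whisker [] (g.src.map φ.ob) * (g.cls.map φ).whisker (f.tgt.map φ.ob) []
      rw [map_mul, Levels.map_whisker, Levels.map_whisker]; rfl)⟩
  dom_mor _ := rfl
  cod_mor _ := rfl
  mor_id _ := Diag.ext' rfl rfl (map_one (Levels.map φ))
  mor_comp _ _ _ := Diag.ext' rfl rfl (map_mul (Levels.map φ) _ _)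

/-- Every planar diagram is built from strands and one-vertex diagrams. -/
theorem Diag.induction {D : TensorScheme.{u} p} {P : Diag D → Prop}
    (h_id : ∀ x, P (Diag.id x)) (h_gen : ∀ f, P (Diag.gen f))
    (h_mul : ∀ f g : Diag D, P f → P g → P (f * g))
    (h_comp : ∀ g f h, P g → P f → P (Diag.comp g f h)) (d : Diag D) : P d := by
  obtain ⟨x, y, _, l, rfl, hl⟩ := d
  induction l generalizing x with
  | nil => cases hl; exact h_id _
  | cons a l ih =>
    obtain ⟨rfl, hl⟩ := hl
    have h₁ : P ((Diag.id a.left * Diag.gen a.gen) * Diag.id a.right) :=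
      h_mul _ _ (h_mul _ _ (h_id _) (h_gen _)) (h_id _)
    have := h_comp _ _ rfl (ih a.cod hl) h₁
    convert this using 1
    refine Diag.ext' rfl rfl ?_
    change Levels.mk [a] * Levels.mk l =
      (Levels.whisker [] a.right (Levels.whisker [] (D.src a.gen) 1 *
        (Levels.mk [⟨[], a.gen, []⟩]).whisker a.left []) *
        Levels.whisker (a.left ++ D.tgt a.gen) [] 1) * Levels.mk l
    simp [Levels.whisker_mk, Layer.whisker]

/-- Strict tensor functors out of the free strict tensor category are determined by their values
on generators. -/
theorem freeObj_hom_ext {D : TensorScheme.{u} p} {V : StrictTensorCat.{u}} {K L : freeObj D ⟶ V}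
    (h₁ : ∀ x : D.Ob, K.ob [x] = L.ob [x]) (h₂ : ∀ f, K.mor (Diag.gen f) = L.mor (Diag.gen f)) :
    K = L := by
  have h₁' : ∀ x : List D.Ob, K.ob x = L.ob x := by
    intro x
    induction x with
    | nil => exact (map_one K.ob).trans (map_one L.ob).symm
    | cons a x ih =>
      exact (map_mul K.ob [a] x).trans
        ((congrArg₂ (· * ·) (h₁ a) ih).trans (map_mul L.ob [a] x).symm)
  refine StrictTensorCat.Hom.ext' h₁' fun d => ?_
  refine Diag.induction (P := fun f => K.mor f = L.mor f) ?_ h₂ ?_ ?_ d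
  · intro x
    exact (K.mor_id x).trans ((congrArg _ (h₁' x)).trans (L.mor_id x).symm)
  · intro f g hf hg
    exact (map_mul K.mor f g).trans
      ((congrArg₂ (· * ·) hf hg).trans (map_mul L.mor f g).symm)
  · intro g f h hg hf
    exact (K.mor_comp g f h).trans ((V.comp_congr hg hf _ _).trans (L.mor_comp g f h).symm)

/-- The free functor `F` from tensor schemes to strict tensor categories. -/
def free (p : Bool) : TensorScheme.{u} p ⥤ StrictTensorCat.{u} where
  obj := freeObj
  map := freeMap
  map_id _ := freeObj_hom_ext (fun _ => rfl) fun _ => Diag.ext' (List.map_id _) (List.map_id _) rfl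
  map_comp φ ψ := freeObj_hom_ext (fun _ => rfl) fun _ =>
    Diag.ext' (List.comp_map ψ.ob φ.ob _) (List.comp_map ψ.ob φ.ob _) rfl

/-! ## The underlying tensor scheme of a strict tensor category, and evaluation of diagrams -/

/-- A prime diagram `x₁ ⋯ xₘ → y₁ ⋯ yₙ` in a strict tensor category: one vertex with input strands
`x₁, …, xₘ` and output strands `y₁, …, yₙ`, decorated by a morphism
`x₁ ⊗ ⋯ ⊗ xₘ → y₁ ⊗ ⋯ ⊗ yₙ`. -/
structure Prime (p : Bool) (V : StrictTensorCat.{u}) : Type u where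
  src : List V.Ob
  tgt : List V.Ob
  mor : V.Mor
  dom_mor : V.dom mor = src.prod
  cod_mor : V.cod mor = tgt.prod
  src_ne : p = true → src ≠ []
  tgt_ne : p = true → tgt ≠ []

theorem Prime.ext' {V : StrictTensorCat.{u}} {f g : Prime p V} (h₁ : f.src = g.src)
    (h₂ : f.tgt = g.tgt) (h₃ : f.mor = g.mor) : f = g := by
  cases f; cases g; cases h₁; cases h₂; cases h₃; rfl

/-- The tensor scheme of prime diagrams in a strict tensor category. -/
abbrev forgetObj (p : Bool) (V : StrictTensorCat.{u}) : TensorScheme.{u} p where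
  Ob := V.Ob
  Mor := Prime p V
  src := Prime.src
  tgt := Prime.tgt
  src_ne h f := f.src_ne h
  tgt_ne h f := f.tgt_ne h

/-- The functor `U` from strict tensor categories to tensor schemes. -/
def forget (p : Bool) : StrictTensorCat.{u} ⥤ TensorScheme.{u} p where
  obj V := forgetObj p V
  map {V W} K :=
    { ob := K.ob
      mor := fun f =>
        { src := f.src.map K.ob
          tgt := f.tgt.map K.ob
          mor := K.mor f.mor
          dom_mor := by rw [K.dom_mor, f.dom_mor, map_list_prod]
          cod_mor := by rw [K.cod_mor, f.cod_mor, map_list_prod]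
          src_ne := fun h => by simpa using f.src_ne h
          tgt_ne := fun h => by simpa using f.tgt_ne h }
      src_mor := fun _ => rfl
      tgt_mor := fun _ => rfl }
  map_id V := TensorScheme.Hom.ext' (fun _ => rfl) fun _ =>
    Prime.ext' (List.map_id _) (List.map_id _) rfl
  map_comp K L := TensorScheme.Hom.ext' (fun _ => rfl) fun _ =>
    Prime.ext' (List.comp_map L.ob K.ob _) (List.comp_map L.ob K.ob _) rfl

/-- The unit: a morphism `f : x₁ ⋯ xₘ → y₁ ⋯ yₙ` goes to the prime diagram in the free strict
tensor category with strands `x₁, …, xₘ` and `y₁, …, yₙ` (words of length one), decorated by the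
one-vertex diagram of `f`. -/
def unit (D : TensorScheme.{u} p) : D ⟶ forgetObj p (freeObj D) where
  ob x := ([x] : List D.Ob)
  mor f :=
    { src := (D.src f).map fun x => ([x] : List D.Ob)
      tgt := (D.tgt f).map fun x => ([x] : List D.Ob)
      mor := Diag.gen f
      dom_mor := by
        have h : ∀ w : List D.Ob, w = (w.map fun x => ([x] : List D.Ob)).prod := fun w => by
          induction w with
          | nil => rfl
          | cons a w ih => rw [List.map_cons, List.prod_cons, ← ih]; rfl
        exact h _
      cod_mor := by
        have h : ∀ w : List D.Ob, w = (w.map fun x => ([x] : List D.Ob)).prod := fun w => by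
          induction w with
          | nil => rfl
          | cons a w ih => rw [List.map_cons, List.prod_cons, ← ih]; rfl
        exact h _
      src_ne := fun h h' => D.src_ne h f (List.map_eq_nil_iff.1 h')
      tgt_ne := fun h h' => D.tgt_ne h f (List.map_eq_nil_iff.1 h') }
  src_mor _ := rfl
  tgt_mor _ := rfl

section Evaluation

variable {V : StrictTensorCat.{u}}

/-- The value `id ⊗ f ⊗ id` of a level. -/
def levelValue (l : Layer (forgetObj p V)) : V.Mor :=
  V.id (List.prod (α := V.Ob) l.left) * l.gen.mor * V.id (List.prod (α := V.Ob) l.right)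

theorem dom_levelValue (l : Layer (forgetObj p V)) :
    V.dom (levelValue l) = List.prod (α := V.Ob) l.dom := by
  have h : l.dom = l.left ++ l.gen.src ++ l.right := rfl
  simp [levelValue, V.dom_id, l.gen.dom_mor, h, mul_assoc]

theorem cod_levelValue (l : Layer (forgetObj p V)) :
    V.cod (levelValue l) = List.prod (α := V.Ob) l.cod := by
  have h : l.cod = l.left ++ l.gen.tgt ++ l.right := rfl
  simp [levelValue, V.cod_id, l.gen.cod_mor, h, mul_assoc]

open Classical in
/-- Compose a morphism with the morphism `m`, where possible. -/
noncomputable def post (m : V.Mor) (o : Option V.Mor) : Option V.Mor :=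
  o.bind fun f => if h : V.cod f = V.dom m then some (V.comp m f h) else none

theorem post_post (m m' : V.Mor) (h : V.cod m = V.dom m') (o : Option V.Mor) :
    post m' (post m o) = post (V.comp m' m h) o := by
  cases o with
  | none => rfl
  | some f =>
    by_cases hf : V.cod f = V.dom m
    · have h₁ : V.cod (V.comp m f hf) = V.dom m' := (V.cod_comp _ _ _).trans h
      have h₂ : V.cod f = V.dom (V.comp m' m h) := hf.trans (V.dom_comp _ _ _).symm
      simp only [post, Option.bind_some, dif_pos hf, dif_pos h₁, dif_pos h₂, V.assoc m' m f hf h]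
    · have h₂ : ¬ V.cod f = V.dom (V.comp m' m h) := by rwa [V.dom_comp]
      simp only [post, Option.bind_some, dif_neg hf, dif_neg h₂, Option.bind_none]

theorem value_swap (u v w : List V.Ob) (f g : Prime p V) :
    V.comp
      (levelValue (⟨u ++ f.tgt ++ v, g, w⟩ : Layer (forgetObj p V)))
      (levelValue (⟨u, f, v ++ g.src ++ w⟩ : Layer (forgetObj p V)))
      (by rw [dom_levelValue, cod_levelValue]
          simp [Layer.dom, Layer.cod, forgetObj]) =
    V.comp
      (levelValue (⟨u, f, v ++ g.tgt ++ w⟩ : Layer (forgetObj p V)))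
      (levelValue (⟨u ++ f.src ++ v, g, w⟩ : Layer (forgetObj p V)))
      (by rw [dom_levelValue, cod_levelValue]
          simp [Layer.dom, Layer.cod, forgetObj]) := by
  have e₁ : levelValue (⟨u ++ f.tgt ++ v, g, w⟩ : Layer (forgetObj p V)) =
      (V.id u.prod * V.id f.tgt.prod * V.id v.prod) * (g.mor * V.id w.prod) := by
    change V.id (u ++ f.tgt ++ v).prod * g.mor * V.id w.prod = _
    simp [mul_assoc]
  have e₂ : levelValue (⟨u, f, v ++ g.src ++ w⟩ : Layer (forgetObj p V)) =
      (V.id u.prod * f.mor * V.id v.prod) * (V.id g.src.prod * V.id w.prod) := by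
    change V.id u.prod * f.mor * V.id (v ++ g.src ++ w).prod = _
    simp [mul_assoc]
  have e₃ : levelValue (⟨u ++ f.src ++ v, g, w⟩ : Layer (forgetObj p V)) =
      (V.id u.prod * V.id f.src.prod * V.id v.prod) * (g.mor * V.id w.prod) := by
    change V.id (u ++ f.src ++ v).prod * g.mor * V.id w.prod = _
    simp [mul_assoc]
  have e₄ : levelValue (⟨u, f, v ++ g.tgt ++ w⟩ : Layer (forgetObj p V)) =
      (V.id u.prod * f.mor * V.id v.prod) * (V.id g.tgt.prod * V.id w.prod) := by
    change V.id u.prod * f.mor * V.id (v ++ g.tgt ++ w).prod = _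
    simp [mul_assoc]
  have t : ∀ a b c : V.Ob, V.id a * V.id b * V.id c = V.id (a * b * c) := fun a b c => by
    simp
  have hd : ∀ h : Prime p V, V.dom h.mor = h.src.prod := fun h => h.dom_mor
  have hc : ∀ h : Prime p V, V.cod h.mor = h.tgt.prod := fun h => h.cod_mor
  have key : ∀ (a b a' b' : V.Mor) (h₁ : V.cod a = V.dom b) (h₂ : V.cod a' = V.dom b') (m n : V.Mor),
      V.comp b a h₁ = m → V.comp b' a' h₂ = n → ∀ h, V.comp (b * b') (a * a') h = m * n := by
    rintro a b a' b' h₁ h₂ m n rfl rfl h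
    exact V.interchange _ _ _ _ h₁ h₂
  have hl : V.comp _ _ _ = (V.id u.prod * f.mor * V.id v.prod) * (g.mor * V.id w.prod) :=
    key (V.id u.prod * f.mor * V.id v.prod) (V.id u.prod * V.id f.tgt.prod * V.id v.prod)
      (V.id g.src.prod * V.id w.prod) (g.mor * V.id w.prod)
      (by simp [V.cod_id, V.dom_id, hc]) (by simp [V.cod_id, V.dom_id, hd]) _ _
      ((V.comp_congr (t _ _ _) rfl _ (by simp [V.cod_id, V.dom_id, hc])).trans (V.id_comp' _))
      ((V.comp_congr rfl (map_mul V.id _ _).symm _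
        (by simp [V.cod_id, V.dom_id, hd])).trans (V.comp_id' _))
      (by simp [V.cod_id, V.dom_id, hc, hd])
  have hr : V.comp _ _ _ = (V.id u.prod * f.mor * V.id v.prod) * (g.mor * V.id w.prod) :=
    key (V.id u.prod * V.id f.src.prod * V.id v.prod) (V.id u.prod * f.mor * V.id v.prod)
      (g.mor * V.id w.prod) (V.id g.tgt.prod * V.id w.prod)
      (by simp [V.cod_id, V.dom_id, hd]) (by simp [V.cod_id, V.dom_id, hc]) _ _
      ((V.comp_congr rfl (t _ _ _) _ (by simp [V.cod_id, V.dom_id, hd])).trans (V.comp_id' _))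
      ((V.comp_congr (map_mul V.id _ _).symm rfl _
        (by simp [V.cod_id, V.dom_id, hc])).trans (V.id_comp' _))
      (by simp [V.cod_id, V.dom_id, hc, hd])
  exact (V.comp_congr e₁ e₂ _ _).trans (hl.trans (hr.symm.trans (V.comp_congr e₄ e₃ _ _).symm))

/-- Compose a morphism with the values of a sequence of levels, from top to bottom, where
possible. -/
noncomputable def act : Levels (forgetObj p V) →* (Function.End (Option V.Mor))ᵐᵒᵖ :=
  PresentedMonoid.lift (rels := Interchange (forgetObj p V)) 
    (fun l => MulOpposite.op (α := Function.End (Option V.Mor)) (post (levelValue l))) (by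
    rintro _ _ ⟨u, v, w, f, g⟩
    simp only [map_mul, FreeMonoid.lift_eval_of]
    refine congrArg (MulOpposite.op (α := Function.End (Option V.Mor))) (funext fun o => ?_)
    exact (post_post _ _ (by
        rw [dom_levelValue, cod_levelValue]; simp [Layer.dom, Layer.cod]) o).trans
      ((congrArg (fun m => post m o) (value_swap u v w f g)).trans
        (post_post _ _ (by
          rw [dom_levelValue, cod_levelValue]; simp [Layer.dom, Layer.cod]) o).symm))

/-- The value of a diagram, if it is defined. -/
noncomputable def Diag.evalOption (d : Diag (forgetObj p V)) : Option V.Mor :=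
  (act d.cls).unop (some (V.id (List.prod (α := V.Ob) d.src)))

theorem act_mk_cons (a : Layer (forgetObj p V)) (l : List (Layer (forgetObj p V)))
    (o : Option V.Mor) :
    (act (Levels.mk (a :: l))).unop o = (act (Levels.mk l)).unop (post (levelValue a) o) := by
  rw [Levels.mk_cons, map_mul]
  rfl

/-- `m` is the value of the levels `c` between the words `x` and `y`. -/
structure Evals (x : List V.Ob) (c : Levels (forgetObj p V)) (y : List V.Ob) (m : V.Mor) :
    Prop where
  dom : V.dom m = x.prod
  cod : V.cod m = y.prod
  eq : ∀ (f : V.Mor) (h : V.cod f = V.dom m), (act c).unop (some f) = some (V.comp m f h)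

theorem Evals.one (x : List V.Ob) : Evals (p := p) x 1 x (V.id x.prod) where
  dom := V.dom_id _
  cod := V.cod_id _
  eq f h := by rw [map_one, V.id_comp']; rfl

theorem Evals.mul {x y z : List V.Ob} {c c' : Levels (forgetObj p V)} {m m' : V.Mor}
    (hm : Evals x c y m) (hm' : Evals y c' z m') :
    Evals x (c * c') z (V.comp m' m (hm.cod.trans hm'.dom.symm)) where
  dom := by rw [V.dom_comp, hm.dom]
  cod := by rw [V.cod_comp, hm'.cod]
  eq f h := by
    have h₁ : V.cod f = V.dom m := h.trans (V.dom_comp _ _ _)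
    rw [map_mul]
    change (act c').unop ((act c).unop (some f)) = _
    rw [hm.eq f h₁, hm'.eq _ ((V.cod_comp _ _ _).trans (hm.cod.trans hm'.dom.symm)),
      V.assoc _ _ _ h₁]

theorem Evals.single (a : Layer (forgetObj p V)) :
    Evals a.dom (Levels.mk [a]) a.cod (levelValue a) where
  dom := dom_levelValue a
  cod := cod_levelValue a
  eq f h := by
    rw [act_mk_cons, Levels.mk_nil, map_one]
    change post (levelValue a) (some f) = _
    simp [post, h]

theorem Evals.unique {x y y' : List V.Ob} {c : Levels (forgetObj p V)} {m m' : V.Mor}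
    (h : Evals x c y m) (h' : Evals x c y' m') : m = m' := by
  have h₁ : V.cod (V.id x.prod) = V.dom m := (V.cod_id _).trans h.dom.symm
  have h₂ : V.cod (V.id x.prod) = V.dom m' := (V.cod_id _).trans h'.dom.symm
  have := (h.eq _ h₁).symm.trans (h'.eq _ h₂)
  rwa [V.comp_id', V.comp_id', Option.some_inj] at this

theorem Evals.congr {x x' y y' : List V.Ob} {c c' : Levels (forgetObj p V)} {m m' : V.Mor}
    (h : Evals x c y m) (hx : x = x') (hc : c = c') (hy : y = y') (hm : m = m') :
    Evals x' c' y' m' := by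
  subst hx hc hy hm; exact h

theorem exists_evals : ∀ {x y : List V.Ob} {l : List (Layer (forgetObj p V))},
    Composable x l y → ∃ m, Evals x (Levels.mk l) y m
  | x, _, [], h => by cases h; exact ⟨_, Evals.one x⟩
  | _, _, a :: l, h => by
    obtain ⟨rfl, h⟩ := h
    obtain ⟨m, hm⟩ := exists_evals h
    exact ⟨_, (Evals.single a).mul hm⟩

theorem levelValue_whisker (u v : List V.Ob) (a : Layer (forgetObj p V)) :
    levelValue (a.whisker u v) = V.id u.prod * levelValue a * V.id v.prod := by
  change V.id (u ++ a.left).prod * a.gen.mor * V.id (a.right ++ v).prod = _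
  simp [levelValue, mul_assoc]

theorem Evals.whisker (u v : List V.Ob) : ∀ {x y : List V.Ob} {l : List (Layer (forgetObj p V))}
    {m : V.Mor}, Composable x l y → Evals x (Levels.mk l) y m →
    Evals (u ++ x ++ v) ((Levels.mk l).whisker u v) (u ++ y ++ v)
      (V.id u.prod * m * V.id v.prod)
  | x, _, [], m, h, hm => by
    cases h
    have := hm.unique (Evals.one x)
    subst this
    exact (Evals.one (u ++ x ++ v)).congr rfl (map_one _).symm rfl (by simp [mul_assoc])
  | _, y, a :: l, m, h, hm => by
    obtain ⟨rfl, h⟩ := h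
    obtain ⟨m', hm'⟩ := exists_evals h
    obtain rfl := hm.unique ((Evals.single a).mul hm')
    have h₁ := (Evals.single (a.whisker u v)).congr (a.dom_whisker u v)
      (Levels.whisker_mk (D := forgetObj p V) u v [a]).symm (a.cod_whisker u v) (levelValue_whisker u v a)
    refine (h₁.mul (hm'.whisker u v h)).congr rfl (map_mul _ _ _).symm rfl ?_
    have hu : V.cod (V.id u.prod) = V.dom (V.id u.prod) := by rw [V.cod_id, V.dom_id]
    have hv : V.cod (V.id v.prod) = V.dom (V.id v.prod) := by rw [V.cod_id, V.dom_id]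
    have h₂ : V.cod (levelValue a) = V.dom m' := by rw [cod_levelValue, hm'.dom]
    rw [V.interchange _ _ _ _ (by rw [map_mul, map_mul, hu, h₂]) hv,
      V.interchange _ _ _ _ hu h₂, V.id_comp' hu, V.id_comp' hv]

theorem Diag.exists_value (d : Diag (forgetObj p V)) : ∃ m, Evals d.src d.cls d.tgt m := by
  obtain ⟨l, hl, h⟩ := d.valid
  rw [← hl]
  exact exists_evals h

theorem Diag.evalOption_isSome (d : Diag (forgetObj p V)) : d.evalOption.isSome := by
  obtain ⟨m, hm⟩ := d.exists_value
  rw [Diag.evalOption, hm.eq _ ((V.cod_id _).trans hm.dom.symm)]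
  rfl

/-- The value of a diagram in a strict tensor category: compose the values of its levels. -/
noncomputable def Diag.eval (d : Diag (forgetObj p V)) : V.Mor :=
  d.evalOption.get d.evalOption_isSome

theorem Diag.eval_eq {d : Diag (forgetObj p V)} {m : V.Mor} {y : List V.Ob}
    (hm : Evals d.src d.cls y m) : d.eval = m := by
  have h := hm.eq _ ((V.cod_id _).trans hm.dom.symm)
  rw [V.comp_id'] at h
  exact Option.get_of_eq_some _ h

theorem Diag.evals (d : Diag (forgetObj p V)) : Evals d.src d.cls d.tgt d.eval := by
  obtain ⟨m, hm⟩ := d.exists_value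
  rwa [Diag.eval_eq hm]

theorem Diag.eval_gen (f : Prime p V) : (Diag.gen (D := forgetObj p V) f).eval = f.mor := by
  have h := Evals.single (⟨[], f, []⟩ : Layer (forgetObj p V))
  refine Diag.eval_eq (h.congr ?_ rfl rfl ?_)
  · change [] ++ f.src ++ [] = f.src
    simp
  · simp [levelValue]

/-- The counit: the evaluation of diagrams of prime diagrams in a strict tensor category. -/
noncomputable def counit (p : Bool) (V : StrictTensorCat.{u}) : freeObj (forgetObj p V) ⟶ V where
  ob := ⟨⟨List.prod (α := V.Ob), rfl⟩, fun _ _ => List.prod_append⟩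
  mor := ⟨⟨Diag.eval, Diag.eval_eq ((Evals.one []).congr rfl rfl rfl (map_one V.id))⟩, by
    intro f g
    obtain ⟨l, hl, hf⟩ := f.valid
    obtain ⟨l', hl', hg⟩ := g.valid
    have h₁ := f.evals
    have h₂ := g.evals
    rw [← hl] at h₁
    rw [← hl'] at h₂
    have w₁ := (h₁.whisker [] g.src hf).congr rfl (by rw [hl]) rfl rfl
    have w₂ := (h₂.whisker f.tgt [] hg).congr (List.append_nil _) (by rw [hl'])
      (List.append_nil _) rfl
    refine Diag.eval_eq ((w₁.mul w₂).congr rfl rfl rfl ?_)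
    have e₁ : V.cod (Diag.eval f) = V.dom (V.id f.tgt.prod) := by rw [V.dom_id, h₁.cod]
    have e₂ : V.cod (V.id g.src.prod) = V.dom (Diag.eval g) := by rw [V.cod_id, h₂.dom]
    have e : V.cod (Diag.eval f * V.id g.src.prod) = V.dom (V.id f.tgt.prod * Diag.eval g) := by
      rw [map_mul, map_mul, e₁, e₂]
    calc _ = V.comp _ _ e := V.comp_congr (by simp) (by simp) _ _
      _ = _ := by rw [V.interchange _ _ _ _ e₁ e₂, V.id_comp' e₁, V.comp_id' e₂]⟩
  dom_mor f := f.evals.dom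
  cod_mor f := f.evals.cod
  mor_id x := Diag.eval_eq (V := V) (d := Diag.id x) (Evals.one (V := V) x)
  mor_comp g f h := Diag.eval_eq (f.evals.mul (g.evals.congr h.symm rfl rfl rfl))

end Evaluation

/-! ## The monad on tensor schemes and its algebras -/

/-- The free functor is left adjoint to the forgetful functor; the counit is the evaluation of
diagrams. -/
noncomputable def freeForget (p : Bool) : free.{u} p ⊣ forget.{u} p :=
  Adjunction.mkOfUnitCounit
    { unit :=
        { app := unit
          naturality := fun D E φ => by
            have h : ∀ w : List D.Ob, (w.map φ.ob).map (fun x => ([x] : List E.Ob)) =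
                (w.map fun x => ([x] : List D.Ob)).map (List.map φ.ob) := fun w => by simp
            exact TensorScheme.Hom.ext' (fun _ => rfl) fun f =>
              Prime.ext' ((congrArg (List.map _) (φ.src_mor f)).trans (h _))
                ((congrArg (List.map _) (φ.tgt_mor f)).trans (h _))
                (Diag.ext' (φ.src_mor f) (φ.tgt_mor f) rfl) }
      counit :=
        { app := counit p
          naturality := fun V W K => freeObj_hom_ext
            (fun x => by
              exact (List.prod_singleton (α := W.Ob)).trans
                (congrArg K.ob (List.prod_singleton (α := V.Ob)).symm))
            (fun f => by
              exact (Diag.eval_gen (V := W) (((forget p).map K).mor f)).trans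
                (congrArg K.mor (Diag.eval_gen (V := V) f).symm)) }
      left_triangle := by
        ext D
        refine freeObj_hom_ext (fun x => rfl) fun f => ?_
        exact Diag.eval_gen (V := freeObj D) ((unit D).mor f)
      right_triangle := by
        ext V
        refine TensorScheme.Hom.ext' (fun x => List.prod_singleton (α := V.Ob)) fun f => ?_
        have h : ∀ w : List V.Ob, (w.map fun x => ([x] : List V.Ob)).map
            (List.prod (α := V.Ob)) = w := fun w => by
          simp [Function.comp_def]
        exact Prime.ext' (h _) (h _) (Diag.eval_gen f) }

/-- The monad `T = UF` on tensor schemes. -/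
noncomputable def diagMonad (p : Bool) : Monad (TensorScheme.{u} p) := (freeForget p).toMonad

/-- Tensor manifolds: algebras over the monad `T = UF`. -/
abbrev TensorManifold (p : Bool) := (diagMonad.{u} p).Algebra

/-- The comparison functor `Φ`, sending `V` to the tensor manifold `(U V, U ε_V)`. -/
noncomputable def comparison (p : Bool) : StrictTensorCat.{u} ⥤ TensorManifold.{u} p :=
  Monad.comparison (freeForget p)

/-! ## The strict tensor category of a tensor manifold -/

namespace TensorManifold

variable (A : TensorManifold.{u} p)

/-- The underlying tensor scheme. -/
abbrev scheme : TensorScheme.{u} p := A.A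

/-- The structure map `ε : UF(D) → D`. -/
def str : forgetObj p (freeObj A.scheme) ⟶ A.scheme := A.a

/-- The structure map on objects. -/
def fob (w : List A.scheme.Ob) : A.scheme.Ob := A.str.ob w

/-- The prime diagram with one input strand and one output strand, decorated by `γ`. -/
def oneBlock {V : StrictTensorCat.{u}} (γ : V.Mor) : Prime p V where
  src := [V.dom γ]
  tgt := [V.cod γ]
  mor := γ
  dom_mor := by simp
  cod_mor := by simp
  src_ne := by simp
  tgt_ne := by simp

/-- Fusion of a diagram `γ`: the value of the structure map on the prime diagram with one input
strand and one output strand, decorated by `γ`. -/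
def fuse (γ : Diag A.scheme) : A.scheme.Mor :=
  A.str.mor (oneBlock (V := freeObj A.scheme) γ)

theorem src_fuse (γ : Diag A.scheme) : A.scheme.src (A.fuse γ) = [A.fob γ.src] :=
  A.str.src_mor _

theorem tgt_fuse (γ : Diag A.scheme) : A.scheme.tgt (A.fuse γ) = [A.fob γ.tgt] :=
  A.str.tgt_mor _

theorem fob_singleton (x : A.scheme.Ob) : A.fob [x] = x :=
  congrArg (fun φ : A.scheme ⟶ A.scheme => φ.ob x) A.unit

/-- A morphism with a one-letter source and a one-letter target is fixed by fusion. -/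
theorem fuse_gen {f : A.scheme.Mor} {x y : A.scheme.Ob} (hx : A.scheme.src f = [x])
    (hy : A.scheme.tgt f = [y]) : A.fuse (Diag.gen f) = f := by
  have h : A.str.mor ((unit A.scheme).mor f) = f :=
    congrArg (fun φ : A.scheme ⟶ A.scheme => φ.mor f) A.unit
  refine Eq.trans ?_ h
  refine congrArg A.str.mor (Prime.ext' ?_ ?_ rfl)
  · change [A.scheme.src f] = (A.scheme.src f).map fun x => [x]
    rw [hx]; rfl
  · change [A.scheme.tgt f] = (A.scheme.tgt f).map fun x => [x]
    rw [hy]; rfl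

/-- Associativity of the structure map on objects. -/
theorem fob_flatten (w : List (List A.scheme.Ob)) :
    A.fob (List.prod w) = A.fob (w.map A.fob) :=
  congrArg (fun φ : (diagMonad p).obj ((diagMonad p).obj A.scheme) ⟶ A.scheme => φ.ob w) A.assoc

/-- Associativity of the structure map on one-block prime diagrams. -/
theorem fuse_eval (Q : Diag (forgetObj p (freeObj A.scheme))) :
    A.fuse ((counit p (freeObj A.scheme)).mor Q) = A.fuse (Diag.map A.str Q) := by
  have h := congrArg (fun φ : (diagMonad p).obj ((diagMonad p).obj A.scheme) ⟶ A.scheme =>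
    φ.mor (oneBlock (V := freeObj (forgetObj p (freeObj A.scheme))) Q)) A.assoc
  refine Eq.trans ?_ (h.trans ?_)
  · refine congrArg A.str.mor (Prime.ext' ?_ ?_ rfl)
    · exact congrArg (fun x => [x]) ((counit p (freeObj A.scheme)).dom_mor Q)
    · exact congrArg (fun x => [x]) ((counit p (freeObj A.scheme)).cod_mor Q)
  · exact congrArg A.str.mor (Prime.ext' rfl rfl rfl)

/-- Objects, with tensor product `x ⊗ y = ε(xy)` and unit object `ε(∅)`. -/
instance : Monoid A.scheme.Ob where
  mul x y := A.fob [x, y]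
  one := A.fob []
  one_mul x := by
    have h := A.fob_flatten [[], [x]]
    change A.fob [A.fob [], x] = x
    simpa [A.fob_singleton, word_mul, word_one] using h.symm
  mul_one x := by
    have h := A.fob_flatten [[x], []]
    change A.fob [x, A.fob []] = x
    simpa [A.fob_singleton, word_mul, word_one] using h.symm
  mul_assoc x y z := by
    have h₁ := A.fob_flatten [[x, y], [z]]
    have h₂ := A.fob_flatten [[x], [y, z]]
    change A.fob [A.fob [x, y], z] = A.fob [x, A.fob [y, z]]
    simp only [List.map_cons, List.map_nil, A.fob_singleton] at h₁ h₂
    rw [← h₁, ← h₂]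
    rfl

theorem fob_append (u v : List A.scheme.Ob) : A.fob (u ++ v) = A.fob u * A.fob v :=
  (congrArg A.fob (by simp [word_mul] : u ++ v = List.prod [u, v])).trans (A.fob_flatten [u, v])

theorem fob_nil : A.fob [] = 1 := rfl

theorem prod_eq_fob (w : List A.scheme.Ob) : w.prod = A.fob w := by
  induction w with
  | nil => rfl
  | cons x w ih =>
    rw [List.prod_cons, ih, ← List.singleton_append, A.fob_append, A.fob_singleton]

/-- The morphisms with a one-letter source and a one-letter target. -/
structure BlockMor : Type u where
  dom : A.scheme.Ob
  cod : A.scheme.Ob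
  mor : A.scheme.Mor
  src_mor : A.scheme.src mor = [dom]
  tgt_mor : A.scheme.tgt mor = [cod]

variable {A} in
theorem BlockMor.ext' {f g : A.BlockMor} (h : f.mor = g.mor) : f = g := by
  obtain ⟨x, y, f, hx, hy⟩ := f
  obtain ⟨x', y', f', hx', hy'⟩ := g
  obtain rfl : f = f' := h
  obtain rfl : x = x' := List.singleton_injective (hx.symm.trans hx')
  obtain rfl : y = y' := List.singleton_injective (hy.symm.trans hy')
  rfl

/-- Fusion of a diagram, as a morphism with one-letter source and target. -/
def fuseMor (γ : Diag A.scheme) : A.BlockMor :=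
  ⟨A.fob γ.src, A.fob γ.tgt, A.fuse γ, A.src_fuse γ, A.tgt_fuse γ⟩

theorem fuseMor_gen (f : A.BlockMor) : A.fuseMor (Diag.gen f.mor) = f :=
  BlockMor.ext' (A.fuse_gen f.src_mor f.tgt_mor)

/-- The one-vertex diagram whose vertex is the one-block prime diagram of `γ`. -/
def block (γ : Diag A.scheme) : Diag (forgetObj p (freeObj A.scheme)) :=
  Diag.gen (oneBlock (V := freeObj A.scheme) γ)

theorem eval_block (γ : Diag A.scheme) :
    (counit p (freeObj A.scheme)).mor (A.block γ) = γ :=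
  Diag.eval_gen (V := freeObj A.scheme) _

theorem map_block (γ : Diag A.scheme) :
    Diag.map A.str (A.block γ) = Diag.gen (A.fuseMor γ).mor :=
  Diag.ext' (A.src_fuse γ).symm (A.tgt_fuse γ).symm rfl

theorem fuseMor_eval (Q : Diag (forgetObj p (freeObj A.scheme))) :
    A.fuseMor ((counit p (freeObj A.scheme)).mor Q) = A.fuseMor (Diag.map A.str Q) :=
  BlockMor.ext' (A.fuse_eval Q)

instance : Mul A.BlockMor where
  mul f g := A.fuseMor (Diag.gen f.mor * Diag.gen g.mor)

instance : One A.BlockMor where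
  one := A.fuseMor (Diag.id [A.fob []])

theorem fuseMor_mul (γ δ : Diag A.scheme) : A.fuseMor (γ * δ) = A.fuseMor γ * A.fuseMor δ := by
  have h := A.fuseMor_eval (A.block γ *
    A.block δ)
  have h₁ : (counit p (freeObj A.scheme)).mor (A.block γ *
      A.block δ) = γ * δ :=
    (map_mul (counit p (freeObj A.scheme)).mor _ _).trans
      (congrArg₂ (· * ·) (A.eval_block γ) (A.eval_block δ))
  have h₂ : Diag.map A.str (A.block γ *
      A.block δ) =
      Diag.gen (A.fuseMor γ).mor * Diag.gen (A.fuseMor δ).mor :=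
    (map_mul (freeMap A.str).mor _ _).trans
      (congrArg₂ (· * ·) (A.map_block γ) (A.map_block δ))
  rw [h₁, h₂] at h
  exact h

theorem fuseMor_comp (γ δ : Diag A.scheme) (h : δ.tgt = γ.src)
    (h' : (Diag.gen (A.fuseMor δ).mor).tgt = (Diag.gen (A.fuseMor γ).mor).src) :
    A.fuseMor (Diag.comp γ δ h) =
      A.fuseMor (Diag.comp (Diag.gen (A.fuseMor γ).mor) (Diag.gen (A.fuseMor δ).mor) h') := by
  have hd : (A.block δ).tgt =
      (A.block γ).src :=
    congrArg (fun x : List A.scheme.Ob => [x]) h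
  have e := A.fuseMor_eval (Diag.comp (A.block γ)
    (A.block δ) hd)
  have h₁ : (counit p (freeObj A.scheme)).mor (Diag.comp
      (A.block γ)
      (A.block δ) hd) = Diag.comp γ δ h :=
    ((counit p (freeObj A.scheme)).mor_comp _ _ hd).trans
      ((freeObj A.scheme).comp_congr (A.eval_block γ) (A.eval_block δ) _ h)
  have h₂ : Diag.map A.str (Diag.comp
      (A.block γ)
      (A.block δ) hd) =
      Diag.comp (Diag.gen (A.fuseMor γ).mor) (Diag.gen (A.fuseMor δ).mor) h' :=
    ((freeMap A.str).mor_comp _ _ hd).trans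
      ((freeObj A.scheme).comp_congr (A.map_block γ) (A.map_block δ) _ h')
  rw [h₁, h₂] at e
  exact e

theorem fuseMor_id (w : List A.scheme.Ob) :
    A.fuseMor (Diag.id w) = A.fuseMor (Diag.id [A.fob w]) := by
  have h := A.fuseMor_eval (Diag.id [w])
  have h₁ : (counit p (freeObj A.scheme)).mor (Diag.id [w]) = Diag.id w :=
    ((counit p (freeObj A.scheme)).mor_id [w]).trans
      (congrArg Diag.id (List.append_nil w))
  have h₂ : Diag.map A.str (Diag.id [w]) = Diag.id [A.fob w] := (freeMap A.str).mor_id [w]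
  rw [h₁, h₂] at h
  exact h

theorem fuseMor_one : A.fuseMor 1 = 1 := A.fuseMor_id []

/-- Morphisms, with tensor product `f ⊗ g` the fusion of the juxtaposition of `f` and `g`. -/
instance : Monoid A.BlockMor where
  one_mul f := by
    conv_lhs => rw [← A.fuseMor_gen f]
    rw [← A.fuseMor_one, ← A.fuseMor_mul, one_mul, A.fuseMor_gen]
  mul_one f := by
    conv_lhs => rw [← A.fuseMor_gen f]
    rw [← A.fuseMor_one, ← A.fuseMor_mul, mul_one, A.fuseMor_gen]
  mul_assoc f g h := by
    conv_lhs => rw [← A.fuseMor_gen f, ← A.fuseMor_gen g, ← A.fuseMor_gen h]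
    rw [← A.fuseMor_mul, ← A.fuseMor_mul, mul_assoc, A.fuseMor_mul, A.fuseMor_mul,
      A.fuseMor_gen, A.fuseMor_gen, A.fuseMor_gen]

/-- Composition: the fusion of the diagram with `f` above `g`. -/
def BlockMor.comp (g f : A.BlockMor) (h : f.cod = g.dom) : A.BlockMor :=
  A.fuseMor (Diag.comp (Diag.gen g.mor) (Diag.gen f.mor) (by
    change A.scheme.tgt f.mor = A.scheme.src g.mor
    rw [f.tgt_mor, g.src_mor, h]))

theorem comp_fuseMor (γ δ : Diag A.scheme) (h : δ.tgt = γ.src)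
    (h' : (A.fuseMor δ).cod = (A.fuseMor γ).dom) :
    BlockMor.comp A (A.fuseMor γ) (A.fuseMor δ) h' = A.fuseMor (Diag.comp γ δ h) :=
  (A.fuseMor_comp γ δ h _).symm

theorem dom_gen (f : A.BlockMor) : (Diag.gen f.mor).src = [f.dom] := f.src_mor

theorem cod_gen (f : A.BlockMor) : (Diag.gen f.mor).tgt = [f.cod] := f.tgt_mor

theorem gen_composable {g f : A.BlockMor} (h : f.cod = g.dom) :
    (Diag.gen f.mor).tgt = (Diag.gen g.mor).src := by
  rw [A.cod_gen, A.dom_gen, h]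

theorem comp_congr {g g' f f' : A.BlockMor} (hg : g = g') (hf : f = f') (h : f.cod = g.dom)
    (h' : f'.cod = g'.dom) : BlockMor.comp A g f h = BlockMor.comp A g' f' h' := by
  subst hg; subst hf; rfl

/-- The strict tensor category `Ψ(D, ε)` of a tensor manifold `(D, ε)`. -/
def psiObj : StrictTensorCat.{u} where
  Ob := A.scheme.Ob
  Mor := A.BlockMor
  dom := ⟨⟨BlockMor.dom, A.fob_singleton _⟩, fun f g => by
    change A.fob (A.scheme.src f.mor ++ A.scheme.src g.mor) = f.dom * g.dom
    rw [f.src_mor, g.src_mor]; rfl⟩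
  cod := ⟨⟨BlockMor.cod, A.fob_singleton _⟩, fun f g => by
    change A.fob (A.scheme.tgt f.mor ++ A.scheme.tgt g.mor) = f.cod * g.cod
    rw [f.tgt_mor, g.tgt_mor]; rfl⟩
  id := ⟨⟨fun x => A.fuseMor (Diag.id [x]), rfl⟩, fun x y => by
    rw [← A.fuseMor_mul]
    exact (A.fuseMor_id [x, y]).symm.trans
      (congrArg A.fuseMor (map_mul (freeObj A.scheme).id [x] [y]))⟩
  comp := BlockMor.comp A
  dom_id := A.fob_singleton
  cod_id := A.fob_singleton
  dom_comp g f h := by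
    change A.fob (A.scheme.src f.mor) = f.dom
    rw [f.src_mor, A.fob_singleton]
  cod_comp g f h := by
    change A.fob (A.scheme.tgt g.mor) = g.cod
    rw [g.tgt_mor, A.fob_singleton]
  comp_id f := by
    have h : (Diag.id [f.dom]).tgt = (Diag.gen f.mor).src := (A.dom_gen f).symm
    refine Eq.trans (comp_congr A (A.fuseMor_gen f).symm rfl _ ?_)
      ((A.comp_fuseMor (Diag.gen f.mor) (Diag.id [f.dom]) h _).trans ?_)
    · rw [A.fuseMor_gen]; exact A.fob_singleton _
    · have := (freeObj A.scheme).comp_id' (f := Diag.gen f.mor) (x := [f.dom]) h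
      exact (congrArg A.fuseMor this).trans (A.fuseMor_gen f)
  id_comp f := by
    have h : (Diag.gen f.mor).tgt = (Diag.id [f.cod]).src := A.cod_gen f
    refine Eq.trans (comp_congr A rfl (A.fuseMor_gen f).symm _ ?_)
      ((A.comp_fuseMor (Diag.id [f.cod]) (Diag.gen f.mor) h _).trans ?_)
    · rw [A.fuseMor_gen]; exact (A.fob_singleton _).symm
    · have := (freeObj A.scheme).id_comp' (f := Diag.gen f.mor) (x := [f.cod]) h
      exact (congrArg A.fuseMor this).trans (A.fuseMor_gen f)
  assoc k g f h₁ h₂ := by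
    have e₁ := A.gen_composable h₁
    have e₂ := A.gen_composable h₂
    have a := (freeObj A.scheme).assoc (Diag.gen k.mor) (Diag.gen g.mor) (Diag.gen f.mor) e₁ e₂
    have l := A.comp_fuseMor (Diag.gen k.mor) (Diag.comp (Diag.gen g.mor) (Diag.gen f.mor) e₁) e₂
      (congrArg A.fob e₂)
    have r := A.comp_fuseMor (Diag.comp (Diag.gen k.mor) (Diag.gen g.mor) e₂) (Diag.gen f.mor) e₁
      (congrArg A.fob e₁)
    exact (comp_congr A (A.fuseMor_gen k).symm rfl _ _).trans (l.trans
      ((congrArg A.fuseMor a).trans (r.symm.trans (comp_congr A rfl (A.fuseMor_gen f) _ _))))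
  interchange g g' f f' h h' := by
    have e := A.gen_composable h
    have e' := A.gen_composable h'
    have i := (freeObj A.scheme).interchange (Diag.gen g.mor) (Diag.gen g'.mor) (Diag.gen f.mor)
      (Diag.gen f'.mor) e e'
    have ee : (Diag.gen f.mor * Diag.gen f'.mor).tgt = (Diag.gen g.mor * Diag.gen g'.mor).src :=
      congrArg₂ (· ++ ·) e e'
    have l := A.comp_fuseMor (Diag.gen g.mor * Diag.gen g'.mor) (Diag.gen f.mor * Diag.gen f'.mor)
      ee (congrArg A.fob ee)
    exact l.trans ((congrArg A.fuseMor i).trans (A.fuseMor_mul _ _))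

variable {A} {B : TensorManifold.{u} p} (φ : A ⟶ B)

theorem map_fob (w : List A.scheme.Ob) : φ.f.ob (A.fob w) = B.fob (w.map φ.f.ob) :=
  (congrArg (fun ψ : (diagMonad p).obj A.A ⟶ B.A => ψ.ob w) φ.h).symm

theorem map_fuse (γ : Diag A.scheme) : φ.f.mor (A.fuse γ) = B.fuse (Diag.map φ.f γ) :=
  (congrArg (fun ψ : (diagMonad p).obj A.A ⟶ B.A =>
    ψ.mor (oneBlock (V := freeObj A.scheme) γ)) φ.h).symm

/-- The map induced by a morphism of tensor manifolds on morphisms with one-letter source and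
target. -/
def mapBlock (f : A.BlockMor) : B.BlockMor where
  dom := φ.f.ob f.dom
  cod := φ.f.ob f.cod
  mor := φ.f.mor f.mor
  src_mor := by rw [φ.f.src_mor, f.src_mor]; rfl
  tgt_mor := by rw [φ.f.tgt_mor, f.tgt_mor]; rfl

theorem mapBlock_fuseMor (γ : Diag A.scheme) :
    mapBlock φ (A.fuseMor γ) = B.fuseMor (Diag.map φ.f γ) :=
  BlockMor.ext' (map_fuse φ γ)

theorem map_gen (f : A.BlockMor) :
    Diag.map φ.f (Diag.gen f.mor) = Diag.gen (mapBlock φ f).mor :=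
  Diag.ext' (φ.f.src_mor f.mor).symm (φ.f.tgt_mor f.mor).symm rfl

/-- The strict tensor functor `Ψ(φ)` induced by a morphism `φ` of tensor manifolds. -/
def psiMap : A.psiObj ⟶ B.psiObj where
  ob := ⟨⟨φ.f.ob, map_fob φ []⟩, fun x y => map_fob φ [x, y]⟩
  mor := ⟨⟨mapBlock φ, by
      refine (mapBlock_fuseMor φ _).trans ?_
      refine (congrArg B.fuseMor ((freeMap φ.f).mor_id [A.fob []])).trans ?_
      exact congrArg (fun x => B.fuseMor (Diag.id [x])) (map_fob φ [])⟩, fun f g => by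
      refine (mapBlock_fuseMor φ _).trans (congrArg B.fuseMor ?_)
      exact (map_mul (freeMap φ.f).mor _ _).trans
        (congrArg₂ (· * ·) (map_gen φ f) (map_gen φ g))⟩
  dom_mor _ := rfl
  cod_mor _ := rfl
  mor_id x := (mapBlock_fuseMor φ _).trans (congrArg B.fuseMor ((freeMap φ.f).mor_id [x]))
  mor_comp g f h := by
    refine (mapBlock_fuseMor φ _).trans (congrArg B.fuseMor ?_)
    exact ((freeMap φ.f).mor_comp _ _ (A.gen_composable h)).trans
      ((freeObj B.scheme).comp_congr (map_gen φ g) (map_gen φ f) _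
        (B.gen_composable (congrArg φ.f.ob h)))

end TensorManifold

/-- The functor `Ψ` from tensor manifolds to strict tensor categories. -/
def psi (p : Bool) : TensorManifold.{u} p ⥤ StrictTensorCat.{u} where
  obj A := A.psiObj
  map φ := TensorManifold.psiMap φ
  map_id _ := StrictTensorCat.Hom.ext' (fun _ => rfl) fun _ => TensorManifold.BlockMor.ext' rfl
  map_comp _ _ := StrictTensorCat.Hom.ext' (fun _ => rfl) fun _ => TensorManifold.BlockMor.ext' rfl

/-- The morphism `ε_* : D → ΦΨ(D, ε)` of tensor schemes: the identity on objects; a morphism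
`f : x₁ ⋯ xₘ → y₁ ⋯ yₙ` goes to the prime diagram with strands `x₁, …, xₘ` and `y₁, …, yₙ`
decorated by the fusion of `f`. -/
def epsStar (A : TensorManifold.{u} p) : A.A ⟶ ((comparison p).obj ((psi p).obj A)).A :=
  show A.scheme ⟶ forgetObj p A.psiObj from
  { ob := fun x => x
    mor := fun f =>
      { src := A.scheme.src f
        tgt := A.scheme.tgt f
        mor := A.fuseMor (Diag.gen f)
        dom_mor := (A.prod_eq_fob _).symm
        cod_mor := (A.prod_eq_fob _).symm
        src_ne := fun h => A.scheme.src_ne h f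
        tgt_ne := fun h => A.scheme.tgt_ne h f }
    src_mor := fun f => (List.map_id (A.scheme.src f)).symm
    tgt_mor := fun f => (List.map_id (A.scheme.tgt f)).symm }

end TensorManifolds

namespace TensorManifolds

/-! ### Fusion as a functor, and the unit of the adjunction. -/

namespace TensorManifold

variable {p : Bool} (A : TensorManifold.{u} p)

/-! Everything rests on one observation: the associativity law of the algebra, read on prime
diagrams with one input and one output strand, says that fusing the value of a diagram of diagrams
is the same as fusing the diagram obtained by applying `ε` to each vertex. Such prime diagrams are
admitted under both conventions, because even a diagram with null source or target becomes a single
strand in and a single strand out. Hence both conventions have the same proof.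

The law makes `γ ↦ ⟨γ⟩` a strict tensor functor from the free category on `D` to `Ψ(D, ε)`
(`fuseHom`). Relabelling a diagram along `ε_*` and then evaluating it in `Ψ(D, ε)` is another such
functor; the two agree on letters and on one-vertex diagrams, hence everywhere
(`freeMap_epsStar_counit`). So in the square that `ε_*` must satisfy, one leg is `U` of fusion. It
sends a prime diagram `P` decorated by `γ` to one decorated by `⟨γ⟩`, while the other leg yields the
decoration `⟨[ε(P)]⟩`. These coincide by the same associativity law, applied to the diagram whose
only vertex is `P` (`fuseMor_gen_str`).

For the counit, note that the structure map of `Φ(V)` is `U` of evaluation, so fusion there returns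
a prime diagram decorated by the value in `V`. A morphism of `ΨΦ(V)` is a morphism of `V` wrapped
between two single strands, and unwrapping it is a strict tensor functor (`decoration`) because
evaluation is one.

Of the triangle identities, one is the unit law of the algebra, by which fusion fixes a morphism
with one-letter source and target. The other says that a one-vertex diagram has its decoration as
value. -/

/-- Fusion of diagrams is a strict tensor functor to `Ψ(D, ε)`. -/
def fuseHom : freeObj A.scheme ⟶ A.psiObj where
  -- The product in `Ψ(D, ε)` is defined by `ε` on two-letter words only; associativity of `ε` on a
  -- word of two words extends multiplicativity to arbitrary words. The next field does the same for
  -- diagrams.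
  ob := ⟨⟨A.fob, A.fob_nil⟩, A.fob_append⟩
  mor := ⟨⟨A.fuseMor, A.fuseMor_one⟩, A.fuseMor_mul⟩
  dom_mor _ := rfl
  cod_mor _ := rfl
  mor_id := A.fuseMor_id
  -- In `Ψ(D, ε)` composability only asks that the fused words `ε(v)` agree, which is weaker than
  -- equality of the words themselves; here the words agree, so applying `ε` suffices.
  mor_comp γ δ h := (A.comp_fuseMor γ δ h (congrArg A.fob h)).symm

/-- The value in `Ψ(D, ε)` of a diagram relabelled along `ε_*` is its fusion. -/
theorem freeMap_epsStar_counit :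
    freeMap (epsStar A) ≫ counit p A.psiObj = A.fuseHom :=
  freeObj_hom_ext
    -- On a letter, evaluation gives a product with one factor and fusion gives `ε(x)`; both are
    -- `x`, the second by the unit law.
    (fun x => (List.prod_singleton (α := A.psiObj.Ob)).trans (A.fob_singleton x).symm)
    (fun f => by
      have h : Diag.map (epsStar A) (Diag.gen f) =
          Diag.gen (D := forgetObj p A.psiObj) ((epsStar A).mor f) :=
        Diag.ext' ((epsStar A).src_mor f).symm ((epsStar A).tgt_mor f).symm rfl
      -- The relabelled diagram still has a single vertex, so its value is the decoration of that
      -- vertex, which `epsStar` sets to be the fusion of `[f]`.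
      exact (congrArg (Diag.eval (V := A.psiObj)) h).trans (Diag.eval_gen (V := A.psiObj) _))

/-- The value of the structure map on a prime diagram has the same fusion as its decoration. -/
theorem fuseMor_gen_str (P : Prime p (freeObj A.scheme)) :
    A.fuseMor (Diag.gen (A.str.mor P)) = A.fuseMor P.mor := by
  -- The test diagram has `P` itself as its vertex, with all its strands, rather than the one-strand
  -- block of `P.mor`. Its value in the free category is `P.mor`, and relabelling it along the
  -- structure map gives the one-vertex diagram of `ε(P)`.
  have h := A.fuseMor_eval (Diag.gen (D := forgetObj p (freeObj A.scheme)) P)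
  have h₁ : (counit p (freeObj A.scheme)).mor (Diag.gen P) = P.mor :=
    Diag.eval_gen (V := freeObj A.scheme) P
  have h₂ : Diag.map A.str (Diag.gen (D := forgetObj p (freeObj A.scheme)) P) =
      Diag.gen (A.str.mor P) :=
    Diag.ext' (A.str.src_mor P).symm (A.str.tgt_mor P).symm rfl
  rw [h₁, h₂] at h
  exact h.symm

/-- `ε_*` is a morphism of tensor manifolds. -/
theorem epsStar_comm :
    (forget p).map (freeMap (epsStar A)) ≫ (forget p).map (counit p A.psiObj) =
      (show (forget p).obj (freeObj A.scheme) ⟶ A.scheme from A.str) ≫ epsStar A :=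
  -- Pulling `U` out of the composite exposes relabelling followed by evaluation, which is replaced
  -- by the fusion functor.
  ((forget p).map_comp _ _).symm.trans
    ((congrArg (fun K => (forget p).map K) A.freeMap_epsStar_counit).trans
      (TensorScheme.Hom.ext' (fun _ => rfl) fun P =>
        -- Both legs apply `ε` to each strand of `P`, so the boundary words match because the
        -- structure map is a morphism of tensor schemes; only the decorations need associativity.
        Prime.ext' (A.str.src_mor P).symm (A.str.tgt_mor P).symm (A.fuseMor_gen_str P).symm))

/-- `ε_*` as a morphism of tensor manifolds. -/
def epsStarHom : A ⟶ (comparison p).obj ((psi p).obj A) where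
  f := epsStar A
  h := A.epsStar_comm

/-- A morphism of algebras commutes with the structure maps, hence with fusion; since `ε_*` changes
only decorations, and these to fusions, nothing else is needed. -/
theorem epsStarHom_naturality {B : TensorManifold.{u} p} (φ : A ⟶ B) :
    φ ≫ B.epsStarHom = A.epsStarHom ≫ (comparison p).map ((psi p).map φ) := by
  refine Monad.Algebra.Hom.ext (TensorScheme.Hom.ext' (fun _ => rfl) fun f => ?_)
  refine Prime.ext' (φ.f.src_mor f) (φ.f.tgt_mor f) ?_
  have h : Diag.map φ.f (Diag.gen f) = Diag.gen (φ.f.mor f) :=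
    Diag.ext' (φ.f.src_mor f).symm (φ.f.tgt_mor f).symm rfl
  exact ((mapBlock_fuseMor φ (Diag.gen f)).trans (congrArg B.fuseMor h)).symm

end TensorManifold

/-! ### The counit, and the triangle identities. -/

/-- The strict tensor functor `ΨΦ(V) ⟶ V` which sends a prime diagram with one input strand and
one output strand to its decoration. -/
noncomputable def decoration (p : Bool) (V : StrictTensorCat.{u}) :
    (psi p).obj ((comparison p).obj V) ⟶ V where
  -- The structure map of `Φ(V)` on words is the product in `V`: the new unit object is an empty
  -- product, and the new tensor product is a product of a two-element list.
  ob := ⟨⟨fun x => x, rfl⟩, fun x y =>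
    show List.prod (α := V.Ob) [x, y] = _ from List.prod_pair⟩
  mor := ⟨⟨fun f => Prime.mor (p := p) (V := V) f.mor,
      -- The unit morphism is by definition the fusion of a strand labelled by the unit object.
      -- `fuseMor_one` rewrites it as the fusion of the empty diagram, whose value is the unit of
      -- `V.Mor` by `map_one`.
      (congrArg (fun f => Prime.mor (p := p) (V := V) (TensorManifold.BlockMor.mor f))
        ((comparison p).obj V).fuseMor_one.symm).trans (map_one (counit p V).mor)⟩, fun f g =>
    -- Up to unfolding, `f ⊗ g` in `ΨΦ(V)` is decorated by the value of `[f] ⊗ [g]`, so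
    -- multiplicativity of evaluation reduces the claim to one-vertex diagrams. Identities and
    -- composites below work the same way.
    (map_mul (counit p V).mor _ _).trans
      (congrArg₂ (· * ·) (Diag.eval_gen (V := V) f.mor) (Diag.eval_gen (V := V) g.mor))⟩
  dom_mor f := (Prime.dom_mor (p := p) (V := V) f.mor).trans
    ((congrArg (List.prod (α := V.Ob)) f.src_mor).trans List.prod_singleton)
  cod_mor f := (Prime.cod_mor (p := p) (V := V) f.mor).trans
    ((congrArg (List.prod (α := V.Ob)) f.tgt_mor).trans List.prod_singleton)
  mor_id x := ((counit p V).mor_id [x]).trans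
    (congrArg V.id (List.prod_singleton (α := V.Ob)))
  mor_comp g f h :=
    ((counit p V).mor_comp _ _ (((comparison p).obj V).gen_composable h)).trans
      (V.comp_congr (Diag.eval_gen (V := V) g.mor) (Diag.eval_gen (V := V) f.mor) _ _)

/-- The functor `Ψ` is left adjoint to the comparison functor, with unit `ε_*`. -/
noncomputable def psiComparison (p : Bool) : psi.{u} p ⊣ comparison.{u} p :=
  Adjunction.mkOfUnitCounit
    { unit :=
        { app := fun A => A.epsStarHom
          naturality := fun A _ φ => A.epsStarHom_naturality φ }
      counit :=
        { app := decoration p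
          -- `U(K)` acts on a prime diagram by applying `K` to its decoration, so unwrapping
          -- commutes with it by definition.
          naturality := fun _ _ _ => StrictTensorCat.Hom.ext' (fun _ => rfl) fun _ => rfl }
      left_triangle := by
        ext A
        -- The composite sends `f` to `⟨[f]⟩`; a morphism of `Ψ(D, ε)` has one-letter source and
        -- target, so the unit law returns `f`.
        exact StrictTensorCat.Hom.ext' (fun _ => rfl) fun f => A.fuseMor_gen f
      right_triangle := by
        refine NatTrans.ext (funext fun V => Monad.Algebra.Hom.ext (TensorScheme.Hom.ext' (fun _ => rfl) fun f => ?_))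
        -- Strands are mapped by the identity, and the decoration becomes the value in `V` of the
        -- diagram with this one vertex.
        exact Prime.ext' (List.map_id _) (List.map_id _) (Diag.eval_gen (V := V) f) }

end TensorManifolds

/-- Prescribing the unit determines the bijection of Hom-sets, which is `adj.homEquiv`. Each
component of the unit lives in the category of algebras, so the equation also records that `ε_*`
underlies a morphism of tensor manifolds. The values `false` and `true` of `p` are conventions (a)
and (b). -/
theorem theorem6p4p6 (p : Bool) :
    ∃ adj : TensorManifolds.psi.{u} p ⊣ TensorManifolds.comparison.{u} p,
      ∀ A : TensorManifolds.TensorManifold.{u} p,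
        (adj.unit.app A).f = TensorManifolds.epsStar A :=
  ⟨TensorManifolds.psiComparison p, fun _ => rfl⟩
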